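/- **Theorem (Sufficient samples for structure learning).** For a tree $T=(V,E)$ on $p$ vertices and parameters $\theta=(\theta_{ij})_{(i,j)\in E}\in\mathbb R^{E}$, let the (zero-field) Ising model on $T$ be the distribution on $\{-1,+1\}^p$ $$P_{T,\theta}(x)=\exp\Big(\sum_{(i,j)\in E}\theta_{ij}x_ix_j-\Phi(\theta)\Big),$$ where $\Phi(\theta)$ is the normalizing constant. Given samples $X^{(1)},\dots,X^{(n)}\in\{-1,+1\}^p$, the Chow–Liu tree is the maximum likelihood tree $$T^{\mathrm{CL}}=\operatorname*{argmax}_{T'}\ \sup_{\theta'\in\mathbb R^{E(T')}}\ \prod_{l=1}^n P_{T',\theta'}(X^{(l)}),$$ where $T'$ ranges over all trees on the $p$ vertices. The Chow–Liu algorithm computes it as a maximum weight spanning tree of the complete graph with edge weights $|\hat\mu_{ij}|$, where $\hat\mu_{ij}=\frac1n\sum_{l=1}^n X^{(l)}_iX^{(l)}_j$. There is a universal constant $C>0$ such that the following holds for all $p,n$, all $\alpha>0$, $\beta\in\mathbb R$, $\delta>0$, every tree $T$ on $p$ vertices and every $\theta$ with $\alpha\le|\theta_{ij}|\le\beta$ for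 all edges $(i,j)$ of $T$. If $$n> C\,e^{2\beta}\max\{\alpha^{-2},1\}\,\log\frac{p}{\delta}$$ and $X^{(1)},\dots,X^{(n)}$ are i.i.d. samples from $P_{T,\theta}$, then with probability at least $1-\delta$ the Chow–Liu algorithm recovers the true tree: the maximum likelihood tree is unique and equal to $T$, and likewise the maximum weight spanning tree for the weights $|\hat\mu_{ij}|$ is unique and equal to $T$ (so that $T^{\mathrm{CL}}=T$ regardless of how ties are broken). -/

import Mathlib

open MeasureTheory

/-- Spin configurations `x ∈ {-1, +1}^p`. -/
abbrev SpinConfig (p : ℕ) : Type := Fin p → ℤˣ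

/-- The product `x_i x_j` of the two spins at the endpoints of the pair `e = {i, j}`. -/
def spinProd {p : ℕ} (x : SpinConfig p) (e : Sym2 (Fin p)) : ℝ :=
  Sym2.lift ⟨fun i j => (((x i : ℤˣ) : ℤ) : ℝ) * (((x j : ℤˣ) : ℤ) : ℝ),
    fun _ _ => mul_comm _ _⟩ e

open scoped Classical in
/-- The exponent `∑_{(i,j) ∈ E(G)} θ_{ij} x_i x_j` of the zero-field Ising model on `G`. Only the
values of `θ` at the edges of `G` matter. -/
noncomputable def isingExponent {p : ℕ} (G : SimpleGraph (Fin p)) (θ : Sym2 (Fin p) → ℝ)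
    (x : SpinConfig p) : ℝ :=
  ∑ e ∈ G.edgeFinset, θ e * spinProd x e

/-- The log-partition function `Φ(θ)`, the normalizing constant of the Ising model. -/
noncomputable def isingLogPartition {p : ℕ} (G : SimpleGraph (Fin p)) (θ : Sym2 (Fin p) → ℝ) : ℝ :=
  Real.log (∑ x : SpinConfig p, Real.exp (isingExponent G θ x))

/-- The probability `P(x) = exp (∑_{(i,j) ∈ E(G)} θ_{ij} x_i x_j - Φ(θ))`. -/
noncomputable def isingProb {p : ℕ} (G : SimpleGraph (Fin p)) (θ : Sym2 (Fin p) → ℝ)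
    (x : SpinConfig p) : ℝ :=
  Real.exp (isingExponent G θ x - isingLogPartition G θ)

theorem isingProb_nonneg {p : ℕ} (G : SimpleGraph (Fin p)) (θ : Sym2 (Fin p) → ℝ)
    (x : SpinConfig p) : 0 ≤ isingProb G θ x :=
  (Real.exp_pos _).le

theorem sum_isingProb {p : ℕ} (G : SimpleGraph (Fin p)) (θ : Sym2 (Fin p) → ℝ) :
    ∑ x : SpinConfig p, isingProb G θ x = 1 := by
  have hpos : 0 < ∑ x : SpinConfig p, Real.exp (isingExponent G θ x) :=
    Finset.sum_pos (fun _ _ => Real.exp_pos _) Finset.univ_nonempty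
  simp only [isingProb, isingLogPartition, Real.exp_sub, Real.exp_log hpos]
  rw [← Finset.sum_div, div_self hpos.ne']

/-- The Ising model with parameters `θ` on `G`, as a probability mass function. -/
noncomputable def isingPMF {p : ℕ} (G : SimpleGraph (Fin p)) (θ : Sym2 (Fin p) → ℝ) :
    PMF (SpinConfig p) :=
  PMF.ofFintype (fun x => ENNReal.ofReal (isingProb G θ x)) (by
    rw [← ENNReal.ofReal_sum_of_nonneg (fun x _ => isingProb_nonneg G θ x), sum_isingProb,
      ENNReal.ofReal_one])

/-- The law of `n` independent samples from the Ising model with parameters `θ` on `G`. -/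
noncomputable def isingSampleLaw {p : ℕ} (G : SimpleGraph (Fin p)) (θ : Sym2 (Fin p) → ℝ)
    (n : ℕ) : Measure (Fin n → SpinConfig p) :=
  Measure.pi fun _ : Fin n => (isingPMF G θ).toMeasure

/-- The largest likelihood of the samples `X` among all Ising models on `G`, with no restriction
on the parameters. It is a supremum, because the maximum is not attained at finite parameters when
some edge has empirical correlation `±1`. -/
noncomputable def maxLikelihood {p n : ℕ} (X : Fin n → SpinConfig p)
    (G : SimpleGraph (Fin p)) : ℝ :=
  ⨆ θ : Sym2 (Fin p) → ℝ, ∏ l : Fin n, isingProb G θ (X l)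

/-- `S` is a Chow-Liu tree of the samples `X`: a maximum likelihood tree among all trees on the
`p` vertices. -/
def IsChowLiuTree {p n : ℕ} (X : Fin n → SpinConfig p) (S : SimpleGraph (Fin p)) : Prop :=
  S.IsTree ∧ ∀ S' : SimpleGraph (Fin p), S'.IsTree → maxLikelihood X S' ≤ maxLikelihood X S

/-- The empirical correlation `(1/n) ∑_l X_i^{(l)} X_j^{(l)}` across the pair `e = {i, j}`. -/
noncomputable def empCorr {p n : ℕ} (X : Fin n → SpinConfig p) (e : Sym2 (Fin p)) : ℝ :=
  (∑ l : Fin n, spinProd (X l) e) / n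

open scoped Classical in
/-- The total weight of `G`, where each edge is weighted by its absolute empirical correlation. -/
noncomputable def corrWeight {p n : ℕ} (X : Fin n → SpinConfig p) (G : SimpleGraph (Fin p)) : ℝ :=
  ∑ e ∈ G.edgeFinset, |empCorr X e|

/-- `S` is a possible output of the Chow-Liu algorithm on the samples `X`: a maximum weight
spanning tree of the complete graph, weighted by absolute empirical correlations. -/
def IsMaxCorrSpanningTree {p n : ℕ} (X : Fin n → SpinConfig p) (S : SimpleGraph (Fin p)) : Prop :=
  S.IsTree ∧ ∀ S' : SimpleGraph (Fin p), S'.IsTree → corrWeight X S' ≤ corrWeight X S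

/-! Everything reduces to a cut condition: whenever a tree edge e separates a nonadjacent pair f =
{u, v}, the empirical correlations satisfy |μ̂_f| < |μ̂_e|. By edge exchange
(`IsTree.sum_lt_sum_of_cut`), T is then the unique maximum spanning tree for any edge weight that is
strictly increasing in |μ̂|. The maximal log-likelihood of a tree is such a weight up to a constant:
the partition function factorizes over edges, so each edge contributes n times the conjugate of log
cosh at μ̂_e (`maxLikelihood_eq`).

The cut condition holds when θ_e (μ̂_e + σ μ̂_f) > 0 for both signs σ. The tilt exp(-θ_e (x_e + σ
x_f) / 2) equals 1 where σ x_e x_f = -1; elsewhere it is exp(-θ_e x_e), which turns the edge factor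
exp(θ_e x_e) into 1. Its mean is therefore 1 - q (1 - 1 / cosh θ_e), with q = P(σ x_e x_f = 1)
(`sum_isingProb_mul_exp`). The path from u to v has a second edge, and flipping the spins on one
side of it reverses x_f but not x_e, whence q ≥ e^{-2β} / 2. A Chernoff bound and a union bound
finish the proof. -/

/-! ### Cuts and edge exchange in trees. -/

namespace SimpleGraph

variable {V : Type*}

/-- A walk that starts in `B` and ends outside of `B` has an edge leaving `B`. -/
theorem Walk.exists_mem_edges_boundary {G : SimpleGraph V} {u v : V} (q : G.Walk u v) (B : Set V)
    (hu : u ∈ B) (hv : v ∉ B) : ∃ a b, s(a, b) ∈ q.edges ∧ G.Adj a b ∧ a ∈ B ∧ b ∉ B := by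
  obtain ⟨d, hd, ha, hb⟩ := q.exists_boundary_dart B hu hv
  exact ⟨d.fst, d.snd, List.mem_map_of_mem (f := Dart.edge) hd, d.adj, ha, hb⟩

/-- In an acyclic graph every edge of a path is a cut edge for the endpoints of the path. -/
theorem IsAcyclic.not_reachable_deleteEdges_of_mem_edges {G : SimpleGraph V} (hG : G.IsAcyclic)
    {u v : V} {q : G.Walk u v} (hq : q.IsPath) {e : Sym2 V} (he : e ∈ q.edges) :
    ¬ (G.deleteEdges {e}).Reachable u v := by
  classical
  intro h
  obtain ⟨r, hr⟩ := h.exists_isPath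
  have hle : G.deleteEdges {e} ≤ G := deleteEdges_le _
  have heq : r.mapLe hle = q :=
    congrArg Subtype.val ((hG.subsingleton_path u v).elim ⟨r.mapLe hle, hr.mapLe hle⟩ ⟨q, hq⟩)
  rw [← heq, Walk.edges_mapLe_eq_edges] at he
  have := r.edges_subset_edgeSet he
  simp at this

/-- Two vertices that are not adjacent in a tree are separated by a tree edge other than `e`. -/
theorem IsTree.exists_ne_not_reachable_deleteEdges {T : SimpleGraph V} (hT : T.IsTree) {u v : V}
    (huv : u ≠ v) (hadj : ¬ T.Adj u v) (e : Sym2 V) :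
    ∃ e' ∈ T.edgeSet, e' ≠ e ∧ ¬ (T.deleteEdges {e'}).Reachable u v := by
  obtain ⟨q, hq⟩ := (hT.connected.preconnected u v).exists_isPath
  -- A path repeats no edge, so if all its edges were `e` it would have length at most one.
  have key : ∃ e' ∈ q.edges, e' ≠ e := by
    by_contra! h
    have hn := hq.isTrail.edges_nodup
    have hl : q.edges.length ≤ 1 := by
      by_contra! h2
      have h0 := h _ (List.getElem_mem (l := q.edges) (n := 0) (by omega))
      have h1 := h _ (List.getElem_mem (l := q.edges) (n := 1) (by omega))
      have := (hn.getElem_inj_iff (hi := by omega) (hj := by omega)).1 (h0.trans h1.symm)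
      omega
    rw [Walk.length_edges] at hl
    interval_cases hq' : q.length
    · exact huv (Walk.eq_of_length_eq_zero hq')
    · exact hadj (Walk.adj_of_length_eq_one hq')
  obtain ⟨e', he', hne⟩ := key
  exact ⟨e', q.edges_subset_edgeSet he', hne,
    hT.isAcyclic.not_reachable_deleteEdges_of_mem_edges hq he'⟩

open scoped Classical in
/-- If every tree edge separating two nonadjacent vertices outweighs the pair they form, then the
tree is the unique maximum weight spanning tree. -/
theorem IsTree.sum_lt_sum_of_cut [Fintype V] {T : SimpleGraph V} (hT : T.IsTree)
    (w : Sym2 V → ℝ)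
    (hw : ∀ e ∈ T.edgeSet, ∀ u v, u ≠ v → ¬ T.Adj u v → ¬ (T.deleteEdges {e}).Reachable u v →
      w s(u, v) < w e)
    {S : SimpleGraph V} (hS : S.IsAcyclic) (hcard : S.edgeFinset.card = T.edgeFinset.card)
    (hne : S ≠ T) : ∑ e ∈ S.edgeFinset, w e < ∑ e ∈ T.edgeFinset, w e := by
  induction hk : (S.edgeFinset \ T.edgeFinset).card using Nat.strong_induction_on generalizing S with
  | _ k ih =>
  have hex : ∃ f ∈ S.edgeFinset, f ∉ T.edgeFinset := by
    by_contra! h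
    exact hne (edgeFinset_inj.1 (Finset.eq_of_subset_of_card_le h hcard.ge))
  obtain ⟨f, hfS, hfT⟩ := hex
  induction f using Sym2.ind with
  | _ u v =>
  rw [mem_edgeFinset, mem_edgeSet] at hfS hfT
  have huv : ¬ (S.deleteEdges {s(u, v)}).Reachable u v :=
    isBridge_iff.1 (isAcyclic_iff_forall_isBridge.1 hS hfS)
  -- The tree path from `u` to `v` leaves the component of `u` in `S` minus `s(u, v)`; the crossing
  -- edge is heavier and replaces `s(u, v)`.
  obtain ⟨q, hq⟩ := (hT.connected.preconnected u v).exists_isPath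
  obtain ⟨a, b, hab, hadj, ha, hb⟩ := q.exists_mem_edges_boundary
    {z | (S.deleteEdges {s(u, v)}).Reachable u z} (Reachable.refl _) huv
  have hnr : ¬ (S.deleteEdges {s(u, v)}).Reachable a b := fun h => hb (Reachable.trans ha h)
  have hlt := hw s(a, b) hadj u v hfS.ne hfT
    (hT.isAcyclic.not_reachable_deleteEdges_of_mem_edges hq hab)
  obtain ⟨S', hS'⟩ : ∃ S', S' = S.deleteEdges {s(u, v)} ⊔ edge a b := ⟨_, rfl⟩
  have hac : S'.IsAcyclic := hS' ▸ (hS.anti (deleteEdges_le _)).sup_edge_of_not_reachable hnr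
  have habS : s(a, b) ∉ S.edgeFinset.erase s(u, v) := by
    intro h
    rw [Finset.mem_erase, mem_edgeFinset, mem_edgeSet] at h
    exact hnr (Adj.reachable (by simpa [deleteEdges_adj] using ⟨h.2, by simpa using h.1⟩))
  have hE : S'.edgeFinset = insert s(a, b) (S.edgeFinset.erase s(u, v)) := by
    ext e
    rw [mem_edgeFinset, hS']
    simp [edgeSet_edge_of_ne hadj.ne, and_comm]
  have hfS' : s(u, v) ∈ S.edgeFinset := by simpa using hfS
  have hsum : ∑ e ∈ S.edgeFinset, w e < ∑ e ∈ S'.edgeFinset, w e := by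
    rw [hE, Finset.sum_insert habS, ← Finset.add_sum_erase _ _ hfS']
    gcongr
  have hcard' : S'.edgeFinset.card = T.edgeFinset.card := by
    rw [hE, Finset.card_insert_of_notMem habS, Finset.card_erase_add_one hfS', hcard]
  by_cases h : S' = T
  · subst h
    exact hsum
  refine hsum.trans (ih _ ?_ hac hcard' h rfl)
  rw [← hk]
  apply Finset.card_lt_card
  rw [Finset.ssubset_iff_of_subset]
  · refine ⟨s(u, v), by simpa using ⟨hfS, hfT⟩, ?_⟩
    rw [hE]
    have : s(u, v) ≠ s(a, b) := fun h => hfT (by rwa [← mem_edgeSet, h])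
    simp [this]
  · intro e he
    rw [hE] at he
    simp only [Finset.mem_sdiff, Finset.mem_insert, Finset.mem_erase] at he ⊢
    rcases he with ⟨rfl | he, h⟩
    · exact absurd (by simpa using hadj) h
    · exact ⟨he.2, h⟩

end SimpleGraph

/-! ### Spin-flip symmetries across a tree edge. -/

theorem spinProd_mk {p : ℕ} (x : SpinConfig p) (i j : Fin p) :
    spinProd x s(i, j) = (((x i : ℤˣ) : ℤ) : ℝ) * (((x j : ℤˣ) : ℤ) : ℝ) := rfl

theorem spinProd_eq_one_or {p : ℕ} (x : SpinConfig p) (e : Sym2 (Fin p)) :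
    spinProd x e = 1 ∨ spinProd x e = -1 := by
  induction e using Sym2.ind with
  | _ i j =>
  rw [spinProd_mk]
  rcases Int.units_eq_one_or (x i) with h | h <;> rcases Int.units_eq_one_or (x j) with h' | h' <;>
    simp [h, h']

theorem abs_spinProd {p : ℕ} (x : SpinConfig p) (e : Sym2 (Fin p)) : |spinProd x e| = 1 := by
  rcases spinProd_eq_one_or x e with h | h <;> simp [h]

open scoped Classical in
/-- Flip all the spins in the set `B`. -/
noncomputable def flipSpins {p : ℕ} (B : Set (Fin p)) : Equiv.Perm (SpinConfig p) :=
  Function.Involutive.toPerm (fun x i => if i ∈ B then -x i else x i) (by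
    intro x
    ext i
    by_cases h : i ∈ B <;> simp [h])

open scoped Classical in
theorem flipSpins_apply {p : ℕ} (B : Set (Fin p)) (x : SpinConfig p) (i : Fin p) :
    flipSpins B x i = if i ∈ B then -x i else x i := rfl

theorem spinProd_flipSpins_of_iff {p : ℕ} {B : Set (Fin p)} {i j : Fin p} (h : i ∈ B ↔ j ∈ B)
    (x : SpinConfig p) : spinProd (flipSpins B x) s(i, j) = spinProd x s(i, j) := by
  by_cases hi : i ∈ B
  · simp [spinProd_mk, flipSpins_apply, hi, h.1 hi]
  · simp [spinProd_mk, flipSpins_apply, hi, mt h.2 hi]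

theorem spinProd_flipSpins_of_mem_of_notMem {p : ℕ} {B : Set (Fin p)} {i j : Fin p} (hi : i ∈ B)
    (hj : j ∉ B) (x : SpinConfig p) : spinProd (flipSpins B x) s(i, j) = -spinProd x s(i, j) := by
  simp [spinProd_mk, flipSpins_apply, hi, hj]

/-- If removing `e` from a connected graph separates `u` from `v`, then some symmetry of the spin
configurations changes the sign of `x_e` and of `x_u x_v`, and preserves `x_g` for all other
edges `g`. -/
theorem exists_perm_spinProd {p : ℕ} {T : SimpleGraph (Fin p)} (hT : T.Connected)
    {e : Sym2 (Fin p)} {u v : Fin p} (h : ¬ (T.deleteEdges {e}).Reachable u v) :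
    ∃ φ : Equiv.Perm (SpinConfig p), (∀ x, spinProd (φ x) e = -spinProd x e) ∧
      (∀ x, spinProd (φ x) s(u, v) = -spinProd x s(u, v)) ∧
      ∀ g ∈ T.edgeSet, g ≠ e → ∀ x, spinProd (φ x) g = spinProd x g := by
  set B : Set (Fin p) := {z | (T.deleteEdges {e}).Reachable u z} with hB
  have huB : u ∈ B := SimpleGraph.Reachable.refl _
  have hvB : v ∉ B := h
  have hiff : ∀ a b, T.Adj a b → s(a, b) ≠ e → (a ∈ B ↔ b ∈ B) := by
    intro a b hab hne
    have hadj : (T.deleteEdges {e}).Adj a b := by simpa [SimpleGraph.deleteEdges_adj] using ⟨hab, hne⟩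
    exact ⟨fun ha => SimpleGraph.Reachable.trans ha hadj.reachable,
      fun hb => SimpleGraph.Reachable.trans hb hadj.symm.reachable⟩
  refine ⟨flipSpins B, fun x => ?_, spinProd_flipSpins_of_mem_of_notMem huB hvB, ?_⟩
  · obtain ⟨q⟩ := hT.preconnected u v
    obtain ⟨a, b, -, hab, ha, hb⟩ := q.exists_mem_edges_boundary B huB hvB
    have he : s(a, b) = e := by
      by_contra hne
      exact hb ((hiff a b hab hne).1 ha)
    rw [← he]
    exact spinProd_flipSpins_of_mem_of_notMem ha hb x
  · intro g hg hne x
    induction g using Sym2.ind with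
    | _ a b => exact spinProd_flipSpins_of_iff (hiff a b hg hne) x

theorem exists_perm_spinProd_of_mem {p : ℕ} {T : SimpleGraph (Fin p)} (hT : T.IsTree)
    {e : Sym2 (Fin p)} (he : e ∈ T.edgeSet) :
    ∃ φ : Equiv.Perm (SpinConfig p), (∀ x, spinProd (φ x) e = -spinProd x e) ∧
      ∀ g ∈ T.edgeSet, g ≠ e → ∀ x, spinProd (φ x) g = spinProd x g := by
  induction e using Sym2.ind with
  | _ u v =>
  obtain ⟨φ, h1, -, h2⟩ := exists_perm_spinProd hT.connected (SimpleGraph.isBridge_iff.1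
    (SimpleGraph.isAcyclic_iff_forall_isBridge.1 hT.isAcyclic he))
  exact ⟨φ, h1, h2⟩

/-! ### Partition function and maximum likelihood of a tree. -/

theorem cosh_eq_of_spinProd {p : ℕ} (t : ℝ) (x : SpinConfig p) (e : Sym2 (Fin p)) :
    Real.cosh t = (Real.exp (t * spinProd x e) + Real.exp (-(t * spinProd x e))) / 2 := by
  rcases spinProd_eq_one_or x e with h | h <;> rw [h, Real.cosh_eq]
  · simp
  · simp [add_comm]

/-- Averaging over a symmetry that flips the sign of `x_e` only. -/
theorem sum_mul_exp_eq_cosh_mul {p : ℕ} {e : Sym2 (Fin p)} (φ : Equiv.Perm (SpinConfig p))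
    (hφ : ∀ x, spinProd (φ x) e = -spinProd x e) (t : ℝ) (h : SpinConfig p → ℝ)
    (hh : ∀ x, h (φ x) = h x) :
    ∑ x, h x * Real.exp (t * spinProd x e) = Real.cosh t * ∑ x, h x := by
  have h1 : ∑ x, h x * Real.exp (t * spinProd x e) = ∑ x, h x * Real.exp (-(t * spinProd x e)) := by
    rw [← Equiv.sum_comp φ]
    refine Finset.sum_congr rfl fun x _ => ?_
    rw [hφ, hh, mul_neg]
  have h2 : Real.cosh t * ∑ x, h x = (∑ x, h x * Real.exp (t * spinProd x e) +
      ∑ x, h x * Real.exp (-(t * spinProd x e))) / 2 := by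
    rw [← Finset.sum_add_distrib, Finset.mul_sum, Finset.sum_div]
    refine Finset.sum_congr rfl fun x _ => ?_
    rw [cosh_eq_of_spinProd t x e]
    ring
  rw [h2, ← h1]
  ring

/-- Edges are peeled off one at a time: the flip across `e` reverses `x_e` alone, so averaging over
it pulls out `cosh (θ e)`. The symmetries come from the full tree `T`, while the edge set `F`
shrinks. -/
theorem sum_exp_sum_edges {p : ℕ} {T : SimpleGraph (Fin p)} (hT : T.IsTree)
    (θ : Sym2 (Fin p) → ℝ) (F : Finset (Sym2 (Fin p))) (hF : ∀ e ∈ F, e ∈ T.edgeSet) :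
    ∑ x : SpinConfig p, Real.exp (∑ e ∈ F, θ e * spinProd x e) =
      2 ^ p * ∏ e ∈ F, Real.cosh (θ e) := by
  classical
  induction F using Finset.induction_on with
  | empty => simp
  | insert e F heF ih =>
    obtain ⟨φ, h1, h2⟩ := exists_perm_spinProd_of_mem hT (hF e (Finset.mem_insert_self _ _))
    have hF' : ∀ g ∈ F, g ∈ T.edgeSet := fun g hg => hF g (Finset.mem_insert_of_mem hg)
    have := sum_mul_exp_eq_cosh_mul φ h1 (θ e)
      (fun x => Real.exp (∑ g ∈ F, θ g * spinProd x g)) (fun x => by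
        congr 1
        refine Finset.sum_congr rfl fun g hg => ?_
        rw [h2 g (hF' g hg) (fun h => heF (h ▸ hg))])
    rw [ih hF'] at this
    rw [Finset.prod_insert heF]
    simp_rw [Finset.sum_insert heF, Real.exp_add, mul_comm (Real.exp (θ e * _))]
    rw [this]
    ring

open scoped Classical in
theorem isingLogPartition_eq {p : ℕ} {T : SimpleGraph (Fin p)} (hT : T.IsTree)
    (θ : Sym2 (Fin p) → ℝ) :
    isingLogPartition T θ = p * Real.log 2 + ∑ e ∈ T.edgeFinset, Real.log (Real.cosh (θ e)) := by
  rw [isingLogPartition]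
  simp only [isingExponent]
  rw [sum_exp_sum_edges hT θ T.edgeFinset (fun e he => by simpa using he),
    Real.log_mul (by positivity) (Finset.prod_pos fun e _ => Real.cosh_pos _).ne',
    Real.log_pow, Real.log_prod fun e _ => (Real.cosh_pos _).ne']

/-- The convex conjugate of `log cosh`: the largest gain in log-likelihood per sample across an
edge with empirical correlation `m`. -/
noncomputable def corrGain (m : ℝ) : ℝ := ⨆ t : ℝ, (t * m - Real.log (Real.cosh t))

theorem bddAbove_corrGain {m : ℝ} (hm : |m| ≤ 1) :
    BddAbove (Set.range fun t : ℝ => t * m - Real.log (Real.cosh t)) := by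
  refine ⟨Real.log 2, ?_⟩
  rintro _ ⟨t, rfl⟩
  have h1 : t * m ≤ |t| := by
    calc t * m ≤ |t * m| := le_abs_self _
      _ = |t| * |m| := abs_mul _ _
      _ ≤ |t| := mul_le_of_le_one_right (abs_nonneg _) hm
  have h2 : |t| ≤ Real.log (2 * Real.cosh t) := by
    rw [Real.le_log_iff_exp_le (by positivity), ← Real.cosh_abs, Real.cosh_eq]
    linarith [Real.exp_pos (-|t|)]
  rw [Real.log_mul (by norm_num) (Real.cosh_pos _).ne'] at h2
  show t * m - _ ≤ _
  linarith

theorem le_corrGain {m : ℝ} (hm : |m| ≤ 1) (t : ℝ) :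
    t * m - Real.log (Real.cosh t) ≤ corrGain m :=
  le_ciSup (bddAbove_corrGain hm) t

theorem corrGain_abs (m : ℝ) : corrGain |m| = corrGain m := by
  rcases abs_choice m with h | h <;> rw [h]
  rw [corrGain, ← (Equiv.neg ℝ).iSup_comp]
  simp [corrGain]

theorem corrGain_pos {m : ℝ} (hm : |m| ≤ 1) (h0 : m ≠ 0) : 0 < corrGain m := by
  refine lt_of_lt_of_le ?_ (le_corrGain hm m)
  have h := Real.log_le_log (Real.cosh_pos m) (Real.cosh_le_exp_half_sq m)
  rw [Real.log_exp] at h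
  have : 0 < m ^ 2 := by positivity
  nlinarith

/-- With `a < b` the absolute values, `log cosh ≥ 0` gives `t a - log cosh t ≤ (a / b) (t b - log
cosh t)`. So the gain at `a` is at most `a / b` times the positive gain at `b`. -/
theorem corrGain_lt_corrGain {m m' : ℝ} (h : |m| < |m'|) (hm' : |m'| ≤ 1) :
    corrGain m < corrGain m' := by
  rw [← corrGain_abs m, ← corrGain_abs m']
  set a := |m|
  have ha : 0 ≤ a := abs_nonneg m
  set b := |m'| with hb
  have hb0 : 0 < b := ha.trans_lt h
  have hb1 : |b| ≤ 1 := by rwa [hb, abs_abs]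
  have hpos := corrGain_pos hb1 hb0.ne'
  have hlt : a / b < 1 := (div_lt_one hb0).2 h
  refine lt_of_le_of_lt (b := a / b * corrGain b) (ciSup_le fun t => ?_) (by nlinarith)
  have h1 := mul_le_mul_of_nonneg_left (le_corrGain hb1 t) (div_nonneg ha hb0.le)
  have h2 : 0 ≤ Real.log (Real.cosh t) := Real.log_nonneg (Real.one_le_cosh t)
  have h3 : a / b * (t * b) = t * a := by field_simp
  nlinarith

theorem abs_empCorr_le_one {p n : ℕ} (X : Fin n → SpinConfig p) (e : Sym2 (Fin p)) :
    |empCorr X e| ≤ 1 := by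
  rw [empCorr, abs_div, Nat.abs_cast]
  refine div_le_one_of_le₀ ((Finset.abs_sum_le_sum_abs _ _).trans ?_) (Nat.cast_nonneg n)
  simp [abs_spinProd]

open scoped Classical in
theorem prod_isingProb {p n : ℕ} (hn : 0 < n) {T : SimpleGraph (Fin p)} (hT : T.IsTree)
    (θ : Sym2 (Fin p) → ℝ) (X : Fin n → SpinConfig p) :
    ∏ l, isingProb T θ (X l) = Real.exp (n * (∑ e ∈ T.edgeFinset,
      (θ e * empCorr X e - Real.log (Real.cosh (θ e))) - p * Real.log 2)) := by
  have hn' : (n : ℝ) ≠ 0 := by positivity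
  simp only [isingProb, ← Real.exp_sum, isingLogPartition_eq hT, isingExponent]
  congr 1
  rw [Finset.sum_sub_distrib, Finset.sum_comm, Finset.sum_sub_distrib]
  simp only [← Finset.mul_sum, Finset.sum_const, Finset.card_univ, Fintype.card_fin, nsmul_eq_mul]
  have : ∑ e ∈ T.edgeFinset, θ e * ∑ l, spinProd (X l) e =
      n * ∑ e ∈ T.edgeFinset, θ e * empCorr X e := by
    rw [Finset.mul_sum]
    refine Finset.sum_congr rfl fun e _ => ?_
    rw [empCorr]
    field_simp
  rw [this]
  ring

open scoped Classical in
/-- The maximal likelihood over a tree is the product of the maximal gains across its edges. -/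
theorem maxLikelihood_eq {p n : ℕ} (hn : 0 < n) {T : SimpleGraph (Fin p)} (hT : T.IsTree)
    (X : Fin n → SpinConfig p) :
    maxLikelihood X T = Real.exp (n * (∑ e ∈ T.edgeFinset, corrGain (empCorr X e) -
      p * Real.log 2)) := by
  have hn' : (0 : ℝ) < n := by positivity
  have hub : ∀ θ : Sym2 (Fin p) → ℝ, ∏ l, isingProb T θ (X l) ≤
      Real.exp (n * (∑ e ∈ T.edgeFinset, corrGain (empCorr X e) - p * Real.log 2)) := by
    intro θ
    rw [prod_isingProb hn hT]
    gcongr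
    exact le_corrGain (abs_empCorr_le_one X _) _
  refine le_antisymm (ciSup_le hub) ?_
  have hbdd : BddAbove (Set.range fun θ : Sym2 (Fin p) → ℝ => ∏ l, isingProb T θ (X l)) :=
    ⟨_, by rintro _ ⟨θ, rfl⟩; exact hub θ⟩
  have hpos : 0 < maxLikelihood X T :=
    lt_of_lt_of_le (Finset.prod_pos fun l _ => Real.exp_pos _) (le_ciSup hbdd 0)
  rw [← Real.le_log_iff_exp_le hpos]
  refine le_of_forall_pos_le_add fun ε hε => ?_
  -- The supremum may not be attained, so each edge gets a near-maximizer with slack `ε / (n c)`.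
  -- The added one keeps `c` positive when there are no edges.
  set c : ℝ := T.edgeFinset.card + 1
  have hc : 0 < c := by positivity
  have hex : ∀ e : Sym2 (Fin p), ∃ t : ℝ, corrGain (empCorr X e) - ε / (n * c) <
      t * empCorr X e - Real.log (Real.cosh t) := fun e =>
    exists_lt_of_lt_ciSup (sub_lt_self _ (by positivity))
  choose θ hθ using hex
  have h1 := le_ciSup hbdd θ
  rw [prod_isingProb hn hT] at h1
  have h2 := (Real.le_log_iff_exp_le hpos).2 h1
  have h3 : ∑ e ∈ T.edgeFinset, corrGain (empCorr X e) - c * (ε / (n * c)) ≤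
      ∑ e ∈ T.edgeFinset, (θ e * empCorr X e - Real.log (Real.cosh (θ e))) := by
    have := Finset.sum_le_sum fun e (_ : e ∈ T.edgeFinset) => (hθ e).le
    rw [Finset.sum_sub_distrib, Finset.sum_const, nsmul_eq_mul] at this
    have h0 : 0 < ε / (n * c) := by positivity
    simp only [c] at h0 ⊢
    nlinarith
  have h4 : n * (c * (ε / (n * c))) = ε := by field_simp
  have h5 := mul_le_mul_of_nonneg_left h3 hn'.le
  rw [mul_sub, h4] at h5
  rw [mul_sub] at h2 ⊢
  linarith

open scoped Classical in
theorem card_edgeFinset_eq_of_isTree {p : ℕ} {S T : SimpleGraph (Fin p)} (hS : S.IsTree)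
    (hT : T.IsTree) : S.edgeFinset.card = T.edgeFinset.card := by
  have h1 := hS.card_edgeFinset
  have h2 := hT.card_edgeFinset
  omega

/-- If all tree edges outweigh the nonadjacent pairs that they separate, then the tree is both the
unique Chow-Liu tree and the unique maximum weight spanning tree. -/
theorem chowLiu_unique_of_cut {p n : ℕ} (hn : 0 < n) {T : SimpleGraph (Fin p)} (hT : T.IsTree)
    (X : Fin n → SpinConfig p)
    (h : ∀ e ∈ T.edgeSet, ∀ u v, u ≠ v → ¬ T.Adj u v → ¬ (T.deleteEdges {e}).Reachable u v →
      |empCorr X s(u, v)| < |empCorr X e|) :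
    (∀ S : SimpleGraph (Fin p), IsChowLiuTree X S ↔ S = T) ∧
      (∀ S : SimpleGraph (Fin p), IsMaxCorrSpanningTree X S ↔ S = T) := by
  have h1 : ∀ S : SimpleGraph (Fin p), S.IsTree → S ≠ T → maxLikelihood X S < maxLikelihood X T := by
    intro S hS hne
    rw [maxLikelihood_eq hn hS, maxLikelihood_eq hn hT]
    have := hT.sum_lt_sum_of_cut (fun e => corrGain (empCorr X e))
      (fun e he u v huv ha hr => corrGain_lt_corrGain (h e he u v huv ha hr)
        (abs_empCorr_le_one X e)) hS.isAcyclic (card_edgeFinset_eq_of_isTree hS hT) hne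
    gcongr
  have h2 : ∀ S : SimpleGraph (Fin p), S.IsTree → S ≠ T → corrWeight X S < corrWeight X T :=
    fun S hS hne => hT.sum_lt_sum_of_cut (fun e => |empCorr X e|) h hS.isAcyclic
      (card_edgeFinset_eq_of_isTree hS hT) hne
  have key : ∀ w : SimpleGraph (Fin p) → ℝ, (∀ S, S.IsTree → S ≠ T → w S < w T) →
      ∀ S, (S.IsTree ∧ ∀ S', S'.IsTree → w S' ≤ w S) ↔ S = T := by
    intro w hw S
    constructor
    · rintro ⟨hS, hmax⟩
      by_contra hne
      exact (hw S hS hne).not_ge (hmax T hT)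
    · rintro rfl
      refine ⟨hT, fun S' hS' => ?_⟩
      by_cases hne : S' = S
      · rw [hne]
      · exact (hw S' hS' hne).le
  exact ⟨key _ h1, key _ h2⟩

/-! ### Exponential moment of the edge comparison. -/

/-- The effect of a flip across the edge `e` on the probability of a configuration. -/
theorem isingProb_perm {p : ℕ} {T : SimpleGraph (Fin p)} (θ : Sym2 (Fin p) → ℝ)
    {e : Sym2 (Fin p)} (he : e ∈ T.edgeSet) (φ : Equiv.Perm (SpinConfig p))
    (h1 : ∀ x, spinProd (φ x) e = -spinProd x e)
    (h2 : ∀ g ∈ T.edgeSet, g ≠ e → ∀ x, spinProd (φ x) g = spinProd x g) (x : SpinConfig p) :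
    isingProb T θ (φ x) = isingProb T θ x * Real.exp (-(2 * θ e * spinProd x e)) := by
  classical
  rw [isingProb, isingProb, ← Real.exp_add]
  congr 1
  have he' : e ∈ T.edgeFinset := by simpa using he
  have hsum : ∑ g ∈ T.edgeFinset.erase e, θ g * spinProd (φ x) g =
      ∑ g ∈ T.edgeFinset.erase e, θ g * spinProd x g := by
    refine Finset.sum_congr rfl fun g hg => ?_
    rw [Finset.mem_erase, SimpleGraph.mem_edgeFinset] at hg
    rw [h2 g hg.2 hg.1]
  rw [isingExponent, isingExponent, ← Finset.add_sum_erase _ _ he', ← Finset.add_sum_erase _ _ he',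
    hsum, h1]
  ring

/-- The probability that `σ x_e x_f = 1`. -/
noncomputable def agreeProb {p : ℕ} (T : SimpleGraph (Fin p)) (θ : Sym2 (Fin p) → ℝ)
    (e f : Sym2 (Fin p)) (σ : ℤˣ) : ℝ :=
  ∑ x, isingProb T θ x * ((1 + ((σ : ℤ) : ℝ) * (spinProd x e * spinProd x f)) / 2)

/-- The exponential moment that controls the comparison of the edge `e` with the pair `f`. -/
theorem sum_isingProb_mul_exp {p : ℕ} {T : SimpleGraph (Fin p)} (hT : T.Connected)
    (θ : Sym2 (Fin p) → ℝ) {e : Sym2 (Fin p)} (he : e ∈ T.edgeSet) {u v : Fin p}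
    (h : ¬ (T.deleteEdges {e}).Reachable u v) (σ : ℤˣ) :
    ∑ x, isingProb T θ x *
        Real.exp (-(θ e * (spinProd x e + ((σ : ℤ) : ℝ) * spinProd x s(u, v)) / 2)) =
      1 - agreeProb T θ e s(u, v) σ * (1 - (Real.cosh (θ e))⁻¹) := by
  obtain ⟨φ, h1, hf, h2⟩ := exists_perm_spinProd hT h
  -- The indicator of `σ x_e x_f = 1`. It is flip-invariant, since the flip reverses both `x_e` and
  -- `x_f`.
  set a : SpinConfig p → ℝ := fun x => (1 + ((σ : ℤ) : ℝ) * (spinProd x e * spinProd x s(u, v))) / 2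
    with ha
  have hcosh : ∑ x, isingProb T θ x * a x * Real.exp (-(θ e * spinProd x e)) =
      (Real.cosh (θ e))⁻¹ * agreeProb T θ e s(u, v) σ := by
    have := sum_mul_exp_eq_cosh_mul φ h1 (θ e)
      (fun x => isingProb T θ x * a x * Real.exp (-(θ e * spinProd x e))) (fun x => by
        simp only [ha]
        rw [isingProb_perm θ he φ h1 h2, h1, hf]
        have : Real.exp (-(2 * θ e * spinProd x e)) * Real.exp (-(θ e * -spinProd x e)) =
            Real.exp (-(θ e * spinProd x e)) := by
          rw [← Real.exp_add]
          congr 1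
          ring
        rw [← this]
        ring)
    simp only [mul_assoc, ← Real.exp_add, neg_add_cancel, Real.exp_zero, mul_one] at this
    simp only [mul_assoc, agreeProb]
    rw [show ∑ x, isingProb T θ x * a x = _ from this, inv_mul_cancel_left₀ (Real.cosh_pos _).ne']
  have hpt : ∀ x, isingProb T θ x *
      Real.exp (-(θ e * (spinProd x e + ((σ : ℤ) : ℝ) * spinProd x s(u, v)) / 2)) =
      isingProb T θ x * a x * Real.exp (-(θ e * spinProd x e)) +
        (isingProb T θ x - isingProb T θ x * a x) := by
    intro x
    simp only [ha]
    rcases spinProd_eq_one_or x e with h | h <;> rcases spinProd_eq_one_or x s(u, v) with h' | h' <;>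
      rcases Int.units_eq_one_or σ with hσ | hσ <;> rw [h, h', hσ] <;> norm_num <;>
      exact Or.inl (by ring)
  rw [Finset.sum_congr rfl fun x _ => hpt x, Finset.sum_add_distrib, Finset.sum_sub_distrib, hcosh,
    sum_isingProb]
  change _ + (1 - agreeProb T θ e s(u, v) σ) = _
  ring

/-- A flip across a separating edge `e' ≠ e` exchanges agreement and disagreement, at the cost of a
factor at least `r = e^{-2β}` in probability. Hence `r (1 - q) ≤ q`, and `r ≤ 1` gives `q ≥ r / 2`.
-/
theorem exp_neg_two_mul_le_agreeProb {p : ℕ} {T : SimpleGraph (Fin p)} (hT : T.IsTree)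
    (θ : Sym2 (Fin p) → ℝ) {β : ℝ} (hβ0 : 0 ≤ β) (hβ : ∀ g ∈ T.edgeSet, |θ g| ≤ β)
    {e : Sym2 (Fin p)} (he : e ∈ T.edgeSet) {u v : Fin p} (huv : u ≠ v) (hadj : ¬ T.Adj u v)
    (σ : ℤˣ) : Real.exp (-(2 * β)) / 2 ≤ agreeProb T θ e s(u, v) σ := by
  obtain ⟨e', he', hne, hr⟩ := hT.exists_ne_not_reachable_deleteEdges huv hadj e
  obtain ⟨φ, h1, hf, h2⟩ := exists_perm_spinProd hT.connected hr
  have hge : Real.exp (-(2 * β)) * (1 - agreeProb T θ e s(u, v) σ) ≤ agreeProb T θ e s(u, v) σ := by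
    conv_rhs => rw [agreeProb, ← Equiv.sum_comp φ]
    have hcompl : 1 - agreeProb T θ e s(u, v) σ = ∑ x, (isingProb T θ x - isingProb T θ x *
        ((1 + ((σ : ℤ) : ℝ) * (spinProd x e * spinProd x s(u, v))) / 2)) := by
      rw [Finset.sum_sub_distrib, sum_isingProb, agreeProb]
    rw [hcompl, Finset.mul_sum]
    refine Finset.sum_le_sum fun x _ => ?_
    rw [isingProb_perm θ he' φ h1 h2, h2 e he hne.symm, hf]
    have hexp : Real.exp (-(2 * β)) ≤ Real.exp (-(2 * θ e' * spinProd x e')) := by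
      rw [Real.exp_le_exp, neg_le_neg_iff]
      calc 2 * θ e' * spinProd x e' = 2 * (θ e' * spinProd x e') := by ring
        _ ≤ 2 * |θ e' * spinProd x e'| := by gcongr; exact le_abs_self _
        _ ≤ 2 * β := by rw [abs_mul, abs_spinProd, mul_one]; gcongr; exact hβ e' he'
    have hP := isingProb_nonneg T θ x
    have ha : 0 ≤ (1 - ((σ : ℤ) : ℝ) * (spinProd x e * spinProd x s(u, v))) / 2 := by
      rcases spinProd_eq_one_or x e with h | h <;>
        rcases spinProd_eq_one_or x s(u, v) with h' | h' <;>
        rcases Int.units_eq_one_or σ with hσ | hσ <;> rw [h, h', hσ] <;> norm_num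
    have := mul_le_mul_of_nonneg_right hexp (mul_nonneg hP ha)
    linear_combination this
  have hle : Real.exp (-(2 * β)) ≤ 1 := Real.exp_le_one_iff.2 (by linarith)
  nlinarith [Real.exp_pos (-(2 * β))]

/-- From `cosh α = 1 + 2 sinh² (α / 2) ≥ 1 + α² / 2`, the right side is at least `α² / (2 + α²) = 1
/ (2 α⁻² + 1)`, whence the 3. -/
theorem one_sub_inv_cosh_ge {α t : ℝ} (hα : 0 < α) (ht : α ≤ |t|) :
    1 / (3 * max (α ^ (-2 : ℤ)) 1) ≤ 1 - (Real.cosh t)⁻¹ := by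
  have h1 : 1 + α ^ 2 / 2 ≤ Real.cosh t := by
    have h2 : Real.cosh α ≤ Real.cosh t := Real.cosh_le_cosh.2 (by rwa [abs_of_pos hα])
    have h3 := Real.cosh_two_mul (α / 2)
    rw [mul_div_cancel₀ α two_ne_zero, Real.cosh_sq] at h3
    have h4 : α / 2 ≤ Real.sinh (α / 2) := Real.self_le_sinh_iff.2 (by positivity)
    nlinarith
  have h2 : (Real.cosh t)⁻¹ ≤ (1 + α ^ 2 / 2)⁻¹ := by gcongr
  refine le_trans ?_ (sub_le_sub_left h2 1)
  have h3 : 1 - (1 + α ^ 2 / 2)⁻¹ = α ^ 2 / (2 + α ^ 2) := by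
    field_simp
    ring
  rw [h3, div_le_div_iff₀ (by positivity) (by positivity)]
  have h4 : α ^ 2 * α ^ (-2 : ℤ) = 1 := by
    rw [zpow_neg]
    exact mul_inv_cancel₀ (by positivity)
  have h5 := mul_le_mul_of_nonneg_left (le_max_left (α ^ (-2 : ℤ)) 1) (sq_nonneg α)
  have h6 := mul_le_mul_of_nonneg_left (le_max_right (α ^ (-2 : ℤ)) 1) (sq_nonneg α)
  linarith

/-! ### Chernoff bound, union bound and conclusion. -/

instance measurableSingletonClass_intUnits : MeasurableSingletonClass ℤˣ :=
  ⟨fun u => ⟨{(u : ℤ)}, measurableSet_singleton _, by ext; simp [Units.ext_iff]⟩⟩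

/-- The Chernoff bound for a function of independent samples from the Ising model. -/
theorem isingSampleLaw_real_sum_le_zero {p : ℕ} (T : SimpleGraph (Fin p)) (θ : Sym2 (Fin p) → ℝ)
    (n : ℕ) (g : SpinConfig p → ℝ) :
    (isingSampleLaw T θ n).real {X | ∑ l, g (X l) ≤ 0} ≤
      (∑ x, isingProb T θ x * Real.exp (-g x)) ^ n := by
  have hprob : IsProbabilityMeasure (isingSampleLaw T θ n) := by
    unfold isingSampleLaw
    infer_instance
  have hint : ∫ X, ∏ l, Real.exp (-g (X l)) ∂(isingSampleLaw T θ n) =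
      (∑ x, isingProb T θ x * Real.exp (-g x)) ^ n := by
    rw [isingSampleLaw, integral_fintype_prod_eq_pow (fun x => Real.exp (-g x)),
      PMF.integral_eq_sum, Fintype.card_fin]
    congr 1
    refine Finset.sum_congr rfl fun x _ => ?_
    simp [isingPMF, isingProb_nonneg]
  rw [← hint]
  -- Markov's inequality at threshold 1: a nonpositive sum makes the product of the `exp (-g)` at
  -- least 1.
  have hmarkov := mul_meas_ge_le_integral_of_nonneg (μ := isingSampleLaw T θ n)
    (f := fun X => ∏ l, Real.exp (-g (X l)))
    (ae_of_all _ fun X => Finset.prod_nonneg fun l _ => (Real.exp_pos _).le) Integrable.of_finite 1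
  rw [one_mul] at hmarkov
  refine le_trans (measureReal_mono fun X hX => ?_) hmarkov
  simp only [Set.mem_ofPred_eq] at hX ⊢
  rw [← Real.exp_sum, Real.one_le_exp_iff, Finset.sum_neg_distrib]
  linarith

/-- The samples fail to separate the edge `e` from the pair `f` in the direction `σ`. -/
def failureSet {p : ℕ} (n : ℕ) (θ : Sym2 (Fin p) → ℝ) (e f : Sym2 (Fin p)) (σ : ℤˣ) :
    Set (Fin n → SpinConfig p) :=
  {X | ∑ l, θ e * (spinProd (X l) e + ((σ : ℤ) : ℝ) * spinProd (X l) f) / 2 ≤ 0}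

theorem isingSampleLaw_real_failureSet_le {p : ℕ} (n : ℕ) {T : SimpleGraph (Fin p)} (hT : T.IsTree)
    {θ : Sym2 (Fin p) → ℝ} {α β : ℝ} (hα : 0 < α)
    (hθ : ∀ g ∈ T.edgeSet, α ≤ |θ g| ∧ |θ g| ≤ β) {e : Sym2 (Fin p)} (he : e ∈ T.edgeSet)
    {u v : Fin p} (huv : u ≠ v) (hadj : ¬ T.Adj u v)
    (h : ¬ (T.deleteEdges {e}).Reachable u v) (σ : ℤˣ) :
    (isingSampleLaw T θ n).real (failureSet n θ e s(u, v) σ) ≤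
      Real.exp (-(n / (6 * Real.exp (2 * β) * max (α ^ (-2 : ℤ)) 1))) := by
  -- The sign of `β` is known only because an edge exists.
  have hβ0 : 0 ≤ β := hα.le.trans ((hθ e he).1.trans (hθ e he).2)
  refine (isingSampleLaw_real_sum_le_zero T θ n
    (fun x => θ e * (spinProd x e + ((σ : ℤ) : ℝ) * spinProd x s(u, v)) / 2)).trans ?_
  have hnn : 0 ≤ ∑ x, isingProb T θ x *
      Real.exp (-(θ e * (spinProd x e + ((σ : ℤ) : ℝ) * spinProd x s(u, v)) / 2)) :=
    Finset.sum_nonneg fun x _ => mul_nonneg (isingProb_nonneg T θ x) (Real.exp_pos _).le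
  set M := max (α ^ (-2 : ℤ)) 1
  have hM : 0 < M := lt_max_of_lt_right one_pos
  have hq := exp_neg_two_mul_le_agreeProb hT θ hβ0 (fun g hg => (hθ g hg).2) he huv hadj σ
  have hc := one_sub_inv_cosh_ge hα (hθ e he).1
  have hmul := mul_le_mul hq hc (by positivity) ((by positivity : (0 : ℝ) ≤ _).trans hq)
  have heq : Real.exp (-(2 * β)) / 2 * (1 / (3 * M)) = 1 / (6 * Real.exp (2 * β) * M) := by
    rw [Real.exp_neg]
    field_simp
    norm_num
  rw [heq] at hmul
  have hle : ∑ x, isingProb T θ x *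
      Real.exp (-(θ e * (spinProd x e + ((σ : ℤ) : ℝ) * spinProd x s(u, v)) / 2)) ≤
      Real.exp (-(1 / (6 * Real.exp (2 * β) * M))) := by
    rw [sum_isingProb_mul_exp hT.connected θ he h σ]
    refine le_trans ?_ (Real.add_one_le_exp _)
    linarith
  refine (pow_le_pow_left₀ hnn hle n).trans_eq ?_
  rw [← Real.exp_nat_mul]
  congr 1
  ring

theorem abs_empCorr_lt_of_notMem_failureSet {p n : ℕ} (hn : 0 < n) {θ : Sym2 (Fin p) → ℝ}
    {e f : Sym2 (Fin p)} {X : Fin n → SpinConfig p} (h : ∀ σ, X ∉ failureSet n θ e f σ) :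
    |empCorr X f| < |empCorr X e| := by
  have hn' : (0 : ℝ) < n := by positivity
  have hsum : ∀ σ : ℤˣ, 0 < θ e * (empCorr X e + ((σ : ℤ) : ℝ) * empCorr X f) := by
    intro σ
    have h1 := h σ
    simp only [failureSet, Set.mem_ofPred_eq, not_le, ← Finset.sum_div, ← Finset.mul_sum,
      Finset.sum_add_distrib] at h1
    have h2 : θ e * (empCorr X e + ((σ : ℤ) : ℝ) * empCorr X f) =
        θ e * (∑ l, spinProd (X l) e + ((σ : ℤ) : ℝ) * ∑ l, spinProd (X l) f) / 2 * (2 / n) := by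
      rw [empCorr, empCorr]
      field_simp
    rw [h2]
    positivity
  have hp := hsum 1
  have hm := hsum (-1)
  simp only [Units.val_one, Int.cast_one, Units.val_neg, Int.cast_neg] at hp hm
  rw [← sq_lt_sq]
  -- The product of the two inequalities is `θ_e² (μ̂_e² - μ̂_f²) > 0`.
  nlinarith [mul_pos hp hm, sq_nonneg (θ e)]

/-- With exponentially small failure probability, all tree edges outweigh the nonadjacent pairs
that they separate. -/
theorem isingSampleLaw_real_compl_cut_le {p n : ℕ} (hn : 0 < n) {T : SimpleGraph (Fin p)}
    (hT : T.IsTree) {θ : Sym2 (Fin p) → ℝ} {α β : ℝ} (hα : 0 < α)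
    (hθ : ∀ g ∈ T.edgeSet, α ≤ |θ g| ∧ |θ g| ≤ β) :
    (isingSampleLaw T θ n).real {X | ∀ e ∈ T.edgeSet, ∀ u v, u ≠ v → ¬ T.Adj u v →
      ¬ (T.deleteEdges {e}).Reachable u v → |empCorr X s(u, v)| < |empCorr X e|}ᶜ ≤
      2 * p ^ 4 * Real.exp (-(n / (6 * Real.exp (2 * β) * max (α ^ (-2 : ℤ)) 1))) := by
  classical
  have hprob : IsProbabilityMeasure (isingSampleLaw T θ n) := by
    unfold isingSampleLaw
    infer_instance
  set ρ := Real.exp (-(n / (6 * Real.exp (2 * β) * max (α ^ (-2 : ℤ)) 1)))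
  -- Irrelevant indices get the empty set, so the union bound has exactly `2 p ^ 4` terms.
  let F : (Fin p × Fin p) × (Fin p × Fin p) × ℤˣ → Set (Fin n → SpinConfig p) := fun k =>
    if s(k.1.1, k.1.2) ∈ T.edgeSet ∧ k.2.1.1 ≠ k.2.1.2 ∧ ¬ T.Adj k.2.1.1 k.2.1.2 ∧
      ¬ (T.deleteEdges {s(k.1.1, k.1.2)}).Reachable k.2.1.1 k.2.1.2
    then failureSet n θ s(k.1.1, k.1.2) s(k.2.1.1, k.2.1.2) k.2.2 else ∅
  have hF : ∀ k, (isingSampleLaw T θ n).real (F k) ≤ ρ := by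
    intro k
    by_cases hk : s(k.1.1, k.1.2) ∈ T.edgeSet ∧ k.2.1.1 ≠ k.2.1.2 ∧ ¬ T.Adj k.2.1.1 k.2.1.2 ∧
      ¬ (T.deleteEdges {s(k.1.1, k.1.2)}).Reachable k.2.1.1 k.2.1.2
    · simp only [F, if_pos hk]
      exact isingSampleLaw_real_failureSet_le n hT hα hθ hk.1 hk.2.1 hk.2.2.1 hk.2.2.2 _
    · simp only [F, if_neg hk, measureReal_empty]
      exact (Real.exp_pos _).le
  calc _ ≤ (isingSampleLaw T θ n).real (⋃ k, F k) := by
        refine measureReal_mono fun X hX => ?_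
        by_contra hnot
        refine hX fun e he u v huv hadj hr => ?_
        induction e using Sym2.ind with
        | _ a b =>
        refine abs_empCorr_lt_of_notMem_failureSet (θ := θ) hn fun σ hσ => hnot ?_
        refine Set.mem_iUnion.2 ⟨((a, b), (u, v), σ), ?_⟩
        simp only [F]
        rwa [if_pos ⟨he, huv, hadj, hr⟩]
    _ ≤ ∑ k, (isingSampleLaw T θ n).real (F k) := measureReal_iUnion_fintype_le _
    _ ≤ ∑ _k : (Fin p × Fin p) × (Fin p × Fin p) × ℤˣ, ρ := Finset.sum_le_sum fun k _ => hF k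
    _ = _ := by
        simp only [Finset.sum_const, Finset.card_univ, Fintype.card_prod, Fintype.card_fin,
          Fintype.card_units_int, nsmul_eq_mul]
        push_cast
        ring

theorem mainTheorem6 :
    ∃ C : ℝ, 0 < C ∧
      ∀ (p n : ℕ) (α β δ : ℝ), 0 < α → 0 < δ →
      ∀ (T : SimpleGraph (Fin p)), T.IsTree →
      ∀ (θ : Sym2 (Fin p) → ℝ), (∀ e ∈ T.edgeSet, α ≤ |θ e| ∧ |θ e| ≤ β) →
      C * Real.exp (2 * β) * max (α ^ (-2 : ℤ)) 1 * Real.log (p / δ) < n →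
      1 - δ ≤ (isingSampleLaw T θ n).real
        {X | (∀ S : SimpleGraph (Fin p), IsChowLiuTree X S ↔ S = T) ∧
             (∀ S : SimpleGraph (Fin p), IsMaxCorrSpanningTree X S ↔ S = T)} := by
  -- 30 = 6 · 5: the 6 is from the Chernoff exponent, and the power 5 of `δ / p` beats the `p ^ 4`
  -- of the union bound.
  refine ⟨30, by norm_num, fun p n α β δ hα hδ T hT θ hθ hnC => ?_⟩
  have hprob : IsProbabilityMeasure (isingSampleLaw T θ n) := by
    unfold isingSampleLaw
    infer_instance
  rcases le_or_gt 1 δ with hδ1 | hδ1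
  · exact (sub_nonpos.2 hδ1).trans measureReal_nonneg
  have hp : 0 < p := by
    obtain ⟨i⟩ := hT.connected.nonempty
    exact i.pos
  set M := max (α ^ (-2 : ℤ)) 1
  have hM : 0 < M := lt_max_of_lt_right one_pos
  have hp1 : (1 : ℝ) ≤ p := by exact_mod_cast hp
  have hlog : 0 < Real.log (p / δ) := Real.log_pos ((one_lt_div hδ).2 (hδ1.trans_le hp1))
  have hn : 0 < n := by
    have : (0 : ℝ) < n := lt_trans (by positivity) hnC
    exact_mod_cast this
  -- The final estimate needs `2 / p ≤ 1`; for `p = 1` the cut condition is vacuous.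
  rcases Nat.eq_or_lt_of_le (Nat.succ_le_of_lt hp) with hp1' | hp2
  · obtain rfl : p = 1 := hp1'.symm
    have huniv : {X : Fin n → SpinConfig 1 | (∀ S, IsChowLiuTree X S ↔ S = T) ∧
        (∀ S, IsMaxCorrSpanningTree X S ↔ S = T)} = Set.univ :=
      Set.eq_univ_of_forall fun X => chowLiu_unique_of_cut hn hT X
        fun e he u v huv => absurd (Subsingleton.elim u v) huv
    rw [huniv, probReal_univ]
    linarith
  have hbound := isingSampleLaw_real_compl_cut_le hn hT hα hθ
  rw [probReal_compl_eq_one_sub (Set.toFinite _).measurableSet] at hbound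
  have hexp : Real.exp (-(n / (6 * Real.exp (2 * β) * M))) ≤ (δ / p) ^ 5 := by
    have h1 : 5 * Real.log (p / δ) ≤ n / (6 * Real.exp (2 * β) * M) := by
      rw [le_div_iff₀ (by positivity)]
      linarith
    have h2 : (δ / p) ^ 5 = Real.exp (-(5 * Real.log (p / δ))) := by
      rw [← inv_div, inv_pow, Real.exp_neg, ← Real.exp_log (x := p / δ) (by positivity),
        ← Real.exp_nat_mul, Real.log_exp]
      norm_num
    rw [h2]
    gcongr
  have hp2' : (2 : ℝ) ≤ p := by exact_mod_cast hp2
  have hfin : 2 * (p : ℝ) ^ 4 * (δ / p) ^ 5 ≤ δ := by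
    have h1 : 2 * (p : ℝ) ^ 4 * (δ / p) ^ 5 = 2 / p * δ ^ 4 * δ := by field_simp
    rw [h1]
    have h2 : 2 / (p : ℝ) ≤ 1 := (div_le_one (by linarith)).2 hp2'
    have h3 : δ ^ 4 ≤ 1 := pow_le_one₀ hδ.le hδ1.le
    have h4 : 2 / (p : ℝ) * δ ^ 4 ≤ 1 := mul_le_one₀ h2 (by positivity) h3
    nlinarith
  have hb2 := mul_le_mul_of_nonneg_left hexp (by positivity : (0 : ℝ) ≤ 2 * p ^ 4)
  refine le_trans ?_ (measureReal_mono
    (Set.ofPred_subset_ofPred.2 fun X hX => chowLiu_unique_of_cut hn hT X hX))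
  linarith
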